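/- Let $\mathrm A\in\mathbb R^{m\times n}$, $b\in\mathbb R^m$, $c\in\mathbb R^n$, let $\mathrm M\in\mathbb R^{n\times n}$ be symmetric positive semidefinite, and write $\mathrm M=\mathrm B^{\intercal}\mathrm B$ with $\mathrm B\in\mathbb R^{r\times n}$. Assume that $\mathcal K=\{x\in\mathbb R^n:\mathrm Ax=b,\ x\ge 0\}$ is nonempty and bounded and that $f(x)=-\frac12x^{\intercal}\mathrm Mx+c^{\intercal}x$ is not constant on $\mathcal K$. Let $\mathsf H(x)=-\sum_i x_i\log x_i$ for $x\ge 0$ (with $0\log 0=0$), and \[ R_{\mathsf H}=\max_{x,x'\in\mathcal K}\{\mathsf H(x)-\mathsf H(x')\},\qquad R_1=\max_{x\in\mathcal K}\|x\|_1 . \] Let $v^{(1)},\dots,v^{(V)}$ be the vertices of $\mathcal K$ and, for $i\in[V]$ and $u\in\mathbb R^r$, let \[ \mathcal C_i=\{u\in\mathbb R^r:(c-\mathrm B^{\intercal}u)^{\intercal}v^{(i)}\le(c-\mathrm B^{\intercal}u)^{\intercal}v^{(j)}\ \text{for all } j\in[V]\},\qquad g_0(u)=\tfrac12\|u\|^2+\min_{x\in\mathcal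 K}(c-\mathrm B^{\intercal}u)^{\intercal}x . \] For $d\in\mathbb R^n$ let $\mathcal O_d=\operatorname{argmin}_{x\in\mathcal K}d^{\intercal}x$ and let $\kappa_d$ be the minimum of $d^{\intercal}v$ over the vertices $v\notin\mathcal O_d$ of $\mathcal K$, minus $\min_{x\in\mathcal O_d}d^{\intercal}x$. Let $\mathcal I^\star=\{i\in[V]:\mathcal C_i\cap\operatorname{argmin}_{\mathbb R^r}g_0\ne\emptyset\}$ and \[ \alpha=\min_{u\in\bigcup_{i\in[V]\setminus\mathcal I^\star}\mathcal C_i}g_0(u)-\min_{u\in\mathbb R^r}g_0(u),\qquad \gamma_i=\operatorname{dist}(\mathrm Bv^{(i)},\operatorname{bd}(\mathcal C_i)), \] \[ \Delta_i=\min\Big\{\kappa_{c-\mathrm B^{\intercal}\mathrm Bv^{(i)}},\ \frac{\gamma_i}{2}\min_{k\in[V]:\,\mathrm Bv^{(k)}\ne\mathrm Bv^{(i)}}\|\mathrm Bv^{(k)}-\mathrm Bv^{(i)}\|\Big\},\qquad \gamma=\min_{i\in\mathcal I^\star}\gamma_i,\quad \Delta=\min_{i\in\mathcal I^\star}\Delta_i,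 \] where minima over, and distances to, the empty set are $+\infty$. Then $R_{\mathsf H},R_1,\alpha,\gamma,\Delta$ are positive and $\Delta$ is finite, and for every \[ 0<\varepsilon<\min\Big\{\frac{\alpha}{R_{\mathsf H}},\ \frac{\gamma^2}{8R_{\mathsf H}},\ \frac{\Delta}{R_1+R_{\mathsf H}}\Big\} \] and every minimizer $x^\star_\varepsilon$ of $f-\varepsilon\mathsf H$ over $\mathcal K$, \[ 0\le f(x^\star_\varepsilon)-\min_{x\in\mathcal K}f(x)\le K\exp\Big(-\frac{\Delta}{\varepsilon R_1}+\frac{R_1+R_{\mathsf H}}{R_1}\Big),\qquad K=\max\{4R_1^2\|\mathrm M\|_{\mathrm{op}},\,2\|c\|R_1\}, \] with $\|c\|$ the Euclidean norm and $\|\mathrm M\|_{\mathrm{op}}$ the Euclidean operator norm. -/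

import Mathlib

namespace EntropicQP

open Set

noncomputable section

/-- `ℝ^d` with its Euclidean norm. -/
abbrev E (d : ℕ) : Type := EuclideanSpace ℝ (Fin d)

/-- The matrix-vector product `L x`, as a linear map between Euclidean spaces. -/
abbrev act {p q : ℕ} (L : Matrix (Fin p) (Fin q) ℝ) : E q →ₗ[ℝ] E p :=
  Matrix.toEuclideanLin L

/-- The operator norm `sup_{‖x‖ = 1} ‖L x‖` with respect to the Euclidean norm. -/
def opNorm {p : ℕ} (L : Matrix (Fin p) (Fin p) ℝ) : ℝ :=
  ‖Matrix.toEuclideanCLM (n := Fin p) (𝕜 := ℝ) L‖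

/-- The feasible set `{x : A x = b, x ≥ 0}`. -/
def feasible {m n : ℕ} (A : Matrix (Fin m) (Fin n) ℝ) (b : E m) : Set (E n) :=
  {x | act A x = b ∧ ∀ i, 0 ≤ x i}

/-- The entropy `-∑ x_i log x_i` (with `0 log 0 = 0`); it is only evaluated at points with
nonnegative coordinates, where it is finite. -/
def entropy {n : ℕ} (x : E n) : ℝ := ∑ i, Real.negMulLog (x i)

/-- The unregularized concave quadratic objective `-½ xᵀ M x + cᵀ x`. -/
def quad {n : ℕ} (M : Matrix (Fin n) (Fin n) ℝ) (c : E n) (x : E n) : ℝ :=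
  -(1 / 2) * inner ℝ x (act M x) + inner ℝ c x

/-- `x` solves the entropically regularized problem `min_{K} (-½ xᵀ M x + cᵀ x - ε H(x))`. -/
def IsSolution {n : ℕ} (K : Set (E n)) (M : Matrix (Fin n) (Fin n) ℝ) (c : E n) (ε : ℝ)
    (x : E n) : Prop :=
  x ∈ K ∧ IsMinOn (fun y => quad M c y - ε * entropy y) K x

/-- `R_H = max_{x, x' ∈ K} (H(x) - H(x'))`. -/
def RH {n : ℕ} (K : Set (E n)) : ℝ :=
  sSup ((fun p : E n × E n => entropy p.1 - entropy p.2) '' (K ×ˢ K))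

/-- `R_1 = max_{x ∈ K} ‖x‖_1`. -/
def R1 {n : ℕ} (K : Set (E n)) : ℝ :=
  sSup ((fun x : E n => ∑ i, |x i|) '' K)

/-- The set of vertices of `K`. -/
def vertices {n : ℕ} (K : Set (E n)) : Set (E n) := K.extremePoints ℝ

/-- The solution set of the linear program `min_{x ∈ K} dᵀ x`. -/
def lpArgmin {n : ℕ} (K : Set (E n)) (d : E n) : Set (E n) :=
  {x | x ∈ K ∧ IsMinOn (fun y => (inner ℝ d y : ℝ)) K x}

/-- The suboptimality gap of the linear program with cost `d`: the least cost of a vertex that is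
not optimal (`+∞` if every vertex is optimal) minus the optimal cost. -/
def kappa {n : ℕ} (K : Set (E n)) (d : E n) : EReal :=
  (⨅ v ∈ vertices K \ lpArgmin K d, ((inner ℝ d v : ℝ) : EReal))
    - ((sInf ((fun y => (inner ℝ d y : ℝ)) '' lpArgmin K d) : ℝ) : EReal)

/-- The cost vector `c - Bᵀ u`. -/
def cost {n r : ℕ} (c : E n) (B : Matrix (Fin r) (Fin n) ℝ) (u : E r) : E n :=
  c - act B.transpose u

/-- The region of all `u` for which the vertex `v` is optimal for the cost `c - Bᵀ u`. -/
def region {n r : ℕ} (K : Set (E n)) (c : E n) (B : Matrix (Fin r) (Fin n) ℝ) (v : E n) :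
    Set (E r) :=
  {u | ∀ w ∈ vertices K, (inner ℝ (cost c B u) v : ℝ) ≤ inner ℝ (cost c B u) w}

/-- `g_ε(u) = ½ ‖u‖² + min_{x ∈ K} ((c - Bᵀ u)ᵀ x - ε H(x))`. -/
def g {n r : ℕ} (K : Set (E n)) (c : E n) (B : Matrix (Fin r) (Fin n) ℝ) (ε : ℝ) (u : E r) : ℝ :=
  1 / 2 * ‖u‖ ^ 2 + sInf ((fun x => (inner ℝ (cost c B u) x : ℝ) - ε * entropy x) '' K)

/-- The vertices whose region contains a global minimizer of `g_0`. -/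
def optVertices {n r : ℕ} (K : Set (E n)) (c : E n) (B : Matrix (Fin r) (Fin n) ℝ) : Set (E n) :=
  {v | v ∈ vertices K ∧ (region K c B v ∩ {u | ∀ u', g K c B 0 u ≤ g K c B 0 u'}).Nonempty}

/-- `α`: the minimum of `g_0` over the regions of the remaining vertices (`+∞` if their union is
empty) minus its global minimum. -/
def alpha {n r : ℕ} (K : Set (E n)) (c : E n) (B : Matrix (Fin r) (Fin n) ℝ) : EReal :=
  (⨅ u ∈ ⋃ v ∈ vertices K \ optVertices K c B, region K c B v, ((g K c B 0 u : ℝ) : EReal))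
    - ((⨅ u, g K c B 0 u : ℝ) : EReal)

/-- `γ_v`: the distance from `B v` to the boundary of the region of `v` (`+∞` if the boundary is
empty). -/
def gammaAt {n r : ℕ} (K : Set (E n)) (c : E n) (B : Matrix (Fin r) (Fin n) ℝ) (v : E n) :
    ENNReal :=
  Metric.infEDist (act B v) (frontier (region K c B v))

/-- `γ`, the minimum of the `γ_v`. -/
def gamma {n r : ℕ} (K : Set (E n)) (c : E n) (B : Matrix (Fin r) (Fin n) ℝ) : ENNReal :=
  ⨅ v ∈ optVertices K c B, gammaAt K c B v

/-- `Δ_v = min {κ_{c - Bᵀ B v}, (γ_v / 2) min_{w : B w ≠ B v} ‖B w - B v‖}`, with minima over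
empty sets equal to `+∞`. -/
def deltaAt {n r : ℕ} (K : Set (E n)) (c : E n) (B : Matrix (Fin r) (Fin n) ℝ) (v : E n) :
    EReal :=
  min (kappa K (cost c B (act B v)))
    ((gammaAt K c B v / 2 * ⨅ w ∈ {w | w ∈ vertices K ∧ act B w ≠ act B v},
      ‖act B w - act B v‖ₑ : ENNReal) : EReal)

/-- `Δ`, the minimum of the `Δ_v`. -/
def delta {n r : ℕ} (K : Set (E n)) (c : E n) (B : Matrix (Fin r) (Fin n) ℝ) : EReal :=
  ⨅ v ∈ optVertices K c B, deltaAt K c B v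

end

end EntropicQP

namespace EntropicQP

open Set

/-! Write `R`, `H` for `R1 K`, `RH K` and `f` for `quad M c`. Completing the square gives `½‖u‖² +
(c - Bᵀu)ᵀx = f(x) + ½‖u - Bx‖²`, so `g_0(u)` is the minimum over `K` of the right-hand side. Hence
`g_0` and `f` have the same minimum, a minimizer of `g_0` in the region of a vertex `v` must be
`Bv`, and on that region `g_0(u) = f(v) + ½‖u - Bv‖²`.

Let `x` solve the regularized problem and `u = Bx`. Then `g_0(u) ≤ f(x) ≤ min f + εH`. The bound by
`α` makes every vertex `v` whose region contains `u` optimal, and the bound by `γ` gives `2‖u - Bv‖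
< γ_v` (`IsSolution.exists_optVertex`). For the cost `d = c - Bᵀu`, each vertex then either has the
same image under `B` and the same linear cost as `v`, or is worse than `v` by at least `Δ`
(`act_eq_or_delta_le`). Unless `x` itself is indistinguishable from `v`, this splits `x = (1 - t)y +
tz` with `y` indistinguishable from `v` and `z` worse by `D ≥ Δ`.

By concavity of `f`, `x` also solves the entropic linear program with cost `d`. Comparing it with
`y` gives `tD ≤ ε(H(x) - H(y))`, and the entropy difference is at most `tH + R(-t log t + t)`
(`entropy_combo_le`). Solving for `t` yields the exponential bound. Finally `f(x) - f(v) = tD +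
½t²‖B(z - v)‖²`, and both terms are estimated by that exponential. -/

theorem inner_act_transpose {n r : ℕ} (B : Matrix (Fin r) (Fin n) ℝ) (u : E r) (x : E n) :
    inner ℝ (act B.transpose u) x = (inner ℝ u (act B x) : ℝ) := by
  have h : act B.transpose = LinearMap.adjoint (act B) := by
    rw [act, act, ← Matrix.toEuclideanLin_conjTranspose_eq_adjoint,
      Matrix.conjTranspose_eq_transpose_of_trivial]
  rw [h, LinearMap.adjoint_inner_left]

theorem inner_cost {n r : ℕ} (c : E n) (B : Matrix (Fin r) (Fin n) ℝ) (u : E r) (x : E n) :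
    (inner ℝ (cost c B u) x : ℝ) = inner ℝ c x - inner ℝ u (act B x) := by
  rw [cost, inner_sub_left, inner_act_transpose]

theorem inner_act_gram {n r : ℕ} (B : Matrix (Fin r) (Fin n) ℝ) (x y : E n) :
    (inner ℝ x (act (B.transpose * B) y) : ℝ) = inner ℝ (act B x) (act B y) := by
  have h : act (B.transpose * B) y = act B.transpose (act B y) := by
    simp [act, Matrix.toEuclideanLin, Matrix.toLpLin_apply]
  rw [h, real_inner_comm, inner_act_transpose, real_inner_comm]

theorem quad_gram {n r : ℕ} (B : Matrix (Fin r) (Fin n) ℝ) (c x : E n) :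
    quad (B.transpose * B) c x = inner ℝ c x - 1 / 2 * ‖act B x‖ ^ 2 := by
  rw [quad, inner_act_gram, real_inner_self_eq_norm_sq]; ring

theorem abs_inner_gram_le {n r : ℕ} (B : Matrix (Fin r) (Fin n) ℝ) (x y : E n) :
    |(inner ℝ (act B x) (act B y) : ℝ)| ≤ opNorm (B.transpose * B) * ‖x‖ * ‖y‖ := by
  rw [← inner_act_gram]
  refine (abs_real_inner_le_norm _ _).trans ?_
  have h : ‖act (B.transpose * B) y‖ ≤ opNorm (B.transpose * B) * ‖y‖ :=
    (Matrix.toEuclideanCLM (n := Fin n) (𝕜 := ℝ) (B.transpose * B)).le_opNorm y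
  calc ‖x‖ * ‖act (B.transpose * B) y‖ ≤ ‖x‖ * (opNorm (B.transpose * B) * ‖y‖) := by gcongr
    _ = _ := by ring

/-- Completing the square; all later links between `g`, `quad` and the linearized costs come from
this identity. -/
theorem half_norm_sq_add_inner_cost {n r : ℕ} (c : E n) (B : Matrix (Fin r) (Fin n) ℝ) (u : E r)
    (x : E n) :
    1 / 2 * ‖u‖ ^ 2 + (inner ℝ (cost c B u) x : ℝ) =
      quad (B.transpose * B) c x + 1 / 2 * ‖u - act B x‖ ^ 2 := by
  rw [quad_gram, inner_cost, norm_sub_sq_real]; ring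

theorem continuous_entropy {n : ℕ} : Continuous (entropy (n := n)) := by
  unfold entropy
  refine continuous_finsetSum _ fun i _ => Real.continuous_negMulLog.comp ?_
  fun_prop

theorem continuous_act {p q : ℕ} (L : Matrix (Fin p) (Fin q) ℝ) : Continuous (act L) :=
  LinearMap.continuous_of_finiteDimensional _

theorem continuous_quad {n : ℕ} (M : Matrix (Fin n) (Fin n) ℝ) (c : E n) :
    Continuous (quad M c) := by
  have := continuous_act M
  unfold quad
  fun_prop

/-! ### The polytope: finitely many vertices, whose hull is the feasible set. -/

section Feasible

variable {m n : ℕ} {A : Matrix (Fin m) (Fin n) ℝ} {b : E m}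

theorem convex_feasible : Convex ℝ (feasible A b) := by
  rintro x ⟨hx, hx0⟩ y ⟨hy, hy0⟩ s t hs ht hst
  refine ⟨?_, fun i => ?_⟩
  · rw [map_add, map_smul, map_smul, hx, hy, ← add_smul, hst, one_smul]
  · have h1 := hx0 i
    have h2 := hy0 i
    simp only [PiLp.add_apply, PiLp.smul_apply, smul_eq_mul]
    positivity

theorem isClosed_feasible : IsClosed (feasible A b) := by
  have h : feasible A b = {x | act A x = b} ∩ ⋂ i, {x | 0 ≤ x i} := by
    ext x; simp [feasible]
  rw [h]
  refine (isClosed_eq (continuous_act A) continuous_const).inter (isClosed_iInter fun i => ?_)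
  exact isClosed_le continuous_const (by fun_prop)

/-- If `w` vanishes wherever `v` does, one can move slightly from `v` away from `w` and stay
feasible, so `v` lies inside a segment starting at `w`. Vertices are thus determined by their zero
sets, which makes them finite in number. -/
theorem eq_of_mem_vertices_of_support {v w : E n} (hv : v ∈ vertices (feasible A b))
    (hw : w ∈ feasible A b) (h : ∀ i, v i = 0 → w i = 0) : v = w := by
  obtain ⟨⟨hvA, hv0⟩, hext⟩ := hv
  have key : ∀ᶠ t : ℝ in nhdsWithin 0 (Ioi 0), ∀ i, 0 ≤ v i + t * (v i - w i) := by
    rw [Filter.eventually_all]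
    intro i
    rcases (hv0 i).eq_or_lt with h0 | h0
    · filter_upwards with t
      rw [← h0, h i h0.symm]; simp
    · have hc : Filter.Tendsto (fun t : ℝ => v i + t * (v i - w i)) (nhds 0)
          (nhds (v i + 0 * (v i - w i))) := Continuous.tendsto (by fun_prop) 0
      rw [zero_mul, add_zero] at hc
      exact nhdsWithin_le_nhds ((hc.eventually (lt_mem_nhds h0)).mono fun t ht => ht.le)
  obtain ⟨t, ht, ht0⟩ := (key.and self_mem_nhdsWithin).exists
  have ht0 : 0 < t := ht0
  have hp : v + t • (v - w) ∈ feasible A b := by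
    refine ⟨?_, fun i => by simpa using ht i⟩
    rw [map_add, map_smul, map_sub, hvA, hw.1]; simp
  have hseg : v ∈ openSegment ℝ w (v + t • (v - w)) := by
    refine ⟨t / (1 + t), 1 / (1 + t), by positivity, by positivity, by field_simp; ring, ?_⟩
    have h1 : (1 + t) ≠ 0 := by positivity
    ext i
    simp only [PiLp.add_apply, PiLp.smul_apply, PiLp.sub_apply, smul_eq_mul]
    field_simp
    ring
  exact (hext hw hp hseg).symm

theorem finite_vertices_feasible : (vertices (feasible A b)).Finite := by
  refine Set.Finite.of_injOn (f := fun v : E n => {i | v i = 0}) (t := Set.univ)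
    (fun _ _ => mem_univ _) ?_ Set.finite_univ
  intro v hv w hw h
  refine eq_of_mem_vertices_of_support hv hw.1 fun i hi => ?_
  exact (Set.ext_iff.1 h i).1 hi

theorem convexHull_vertices_feasible (hb : Bornology.IsBounded (feasible A b)) :
    convexHull ℝ (vertices (feasible A b)) = feasible A b := by
  have hc : IsCompact (feasible A b) := Metric.isCompact_of_isClosed_isBounded isClosed_feasible hb
  have : closure (convexHull ℝ (vertices (feasible A b))) = feasible A b :=
    closure_convexHull_extremePoints hc convex_feasible
  rwa [(finite_vertices_feasible.isClosed_convexHull (𝕜 := ℝ)).closure_eq] at this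

end Feasible

/-! ### Entropy estimates and the constants `RH` and `R1`. -/

section Entropy

variable {n : ℕ}

theorem negMulLog_add_le {a b : ℝ} (ha : 0 ≤ a) (hb : 0 ≤ b) :
    Real.negMulLog (a + b) ≤ Real.negMulLog a + Real.negMulLog b := by
  rcases ha.eq_or_lt with rfl | ha
  · simp
  rcases hb.eq_or_lt with rfl | hb
  · simp
  have h1 := Real.log_le_log ha (by linarith : a ≤ a + b)
  have h2 := Real.log_le_log hb (by linarith : b ≤ a + b)
  simp only [Real.negMulLog]
  nlinarith

theorem negMulLog_one_sub_le {t : ℝ} (ht : t ≤ 1) : Real.negMulLog (1 - t) ≤ t := by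
  rcases ht.eq_or_lt with rfl | h
  · simp
  have h0 : 0 < 1 - t := by linarith
  have := Real.one_sub_inv_le_log_of_pos h0
  have h2 := mul_le_mul_of_nonneg_left this h0.le
  rw [mul_sub, mul_inv_cancel₀ h0.ne'] at h2
  simp only [Real.negMulLog]
  linarith

/-- The defect of concavity of the entropy along a segment is at most a multiple of the binary
entropy. -/
theorem entropy_combo_le {y z : E n} (hy : ∀ i, 0 ≤ y i) (hz : ∀ i, 0 ≤ z i) {R : ℝ}
    (hyR : ∑ i, y i ≤ R) (hzR : ∑ i, z i ≤ R) {t : ℝ} (ht0 : 0 ≤ t) (ht1 : t ≤ 1) :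
    entropy ((1 - t) • y + t • z) ≤
      (1 - t) * entropy y + t * entropy z + R * (Real.negMulLog t + t) := by
  have hpt : ∀ i, Real.negMulLog (((1 - t) • y + t • z) i) ≤
      (y i * Real.negMulLog (1 - t) + (1 - t) * Real.negMulLog (y i)) +
      (z i * Real.negMulLog t + t * Real.negMulLog (z i)) := by
    intro i
    -- The product rule for `negMulLog` reduces the claim to subadditivity.
    rw [← Real.negMulLog_mul, ← Real.negMulLog_mul]
    exact negMulLog_add_le (mul_nonneg (by linarith) (hy i)) (mul_nonneg ht0 (hz i))
  have hsum := Finset.sum_le_sum fun i (_ : i ∈ Finset.univ) => hpt i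
  simp only [Finset.sum_add_distrib, ← Finset.sum_mul, ← Finset.mul_sum] at hsum
  have h1 : (∑ i, y i) * Real.negMulLog (1 - t) ≤ R * t :=
    mul_le_mul hyR (negMulLog_one_sub_le ht1)
      (Real.negMulLog_nonneg (by linarith) (by linarith))
      ((Finset.sum_nonneg fun i _ => hy i).trans hyR)
  have h2 : (∑ i, z i) * Real.negMulLog t ≤ R * Real.negMulLog t :=
    mul_le_mul_of_nonneg_right hzR (Real.negMulLog_nonneg ht0 ht1)
  unfold entropy
  linarith

theorem entropy_midpoint_lt {x y : E n} (hx : ∀ i, 0 ≤ x i) (hy : ∀ i, 0 ≤ y i) (hne : x ≠ y) :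
    (1 / 2 : ℝ) * entropy x + 1 / 2 * entropy y <
      entropy ((1 / 2 : ℝ) • x + (1 / 2 : ℝ) • y) := by
  obtain ⟨j, hj⟩ : ∃ j, x j ≠ y j := by
    by_contra! h
    exact hne (by ext i; exact h i)
  simp only [entropy, Finset.mul_sum, ← Finset.sum_add_distrib]
  refine Finset.sum_lt_sum (fun i _ => ?_) ⟨j, Finset.mem_univ _, ?_⟩
  · exact Real.concaveOn_negMulLog.2 (hx i) (hy i) (by norm_num) (by norm_num) (by norm_num)
  · exact Real.strictConcaveOn_negMulLog.2 (hx j) (hy j) hj (by norm_num) (by norm_num)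
      (by norm_num)

theorem entropy_sub_le_RH {K : Set (E n)} (hK : IsCompact K) {x y : E n} (hx : x ∈ K)
    (hy : y ∈ K) : entropy x - entropy y ≤ RH K := by
  refine le_csSup ?_ ⟨(x, y), ⟨hx, hy⟩, rfl⟩
  refine (hK.prod hK).bddAbove_image (Continuous.continuousOn ?_)
  exact (continuous_entropy.comp continuous_fst).sub (continuous_entropy.comp continuous_snd)

theorem sum_abs_le_R1 {K : Set (E n)} (hK : IsCompact K) {x : E n} (hx : x ∈ K) :
    ∑ i, |x i| ≤ R1 K :=
  le_csSup (hK.bddAbove_image (Continuous.continuousOn (by fun_prop))) ⟨x, hx, rfl⟩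

theorem norm_le_sum_abs (x : E n) : ‖x‖ ≤ ∑ i, |x i| := by
  rw [EuclideanSpace.norm_eq]
  refine Real.sqrt_le_iff.2 ⟨by positivity, ?_⟩
  simpa only [Real.norm_eq_abs] using
    Finset.sum_sq_le_sq_sum_of_nonneg fun i (_ : i ∈ Finset.univ) => abs_nonneg (x i)

/-- Nonnegative vectors have nonnegative inner product, which improves the triangle-inequality
constant from 4 to 2. The final constant relies on this gain. -/
theorem norm_sub_sq_le {x y : E n} (hx : ∀ i, 0 ≤ x i) (hy : ∀ i, 0 ≤ y i) {R : ℝ}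
    (hxR : ‖x‖ ≤ R) (hyR : ‖y‖ ≤ R) : ‖x - y‖ ^ 2 ≤ 2 * R ^ 2 := by
  have h : 0 ≤ (inner ℝ x y : ℝ) := by
    rw [PiLp.inner_apply]
    exact Finset.sum_nonneg fun i _ => by simpa using mul_nonneg (hy i) (hx i)
  rw [norm_sub_sq_real]
  have h1 := pow_le_pow_left₀ (norm_nonneg x) hxR 2
  have h2 := pow_le_pow_left₀ (norm_nonneg y) hyR 2
  linarith

theorem RH_pos {K : Set (E n)} (hK : IsCompact K) (hconv : Convex ℝ K)
    (hpos : ∀ x ∈ K, ∀ i, 0 ≤ x i) (hnt : K.Nontrivial) : 0 < RH K := by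
  obtain ⟨x, hx, y, hy, hne⟩ := hnt
  have h := entropy_midpoint_lt (hpos x hx) (hpos y hy) hne
  have hm : (1 / 2 : ℝ) • x + (1 / 2 : ℝ) • y ∈ K :=
    hconv hx hy (by norm_num) (by norm_num) (by norm_num)
  have h1 := entropy_sub_le_RH hK hm hx
  have h2 := entropy_sub_le_RH hK hm hy
  linarith

theorem R1_pos {K : Set (E n)} (hK : IsCompact K) (hnt : K.Nontrivial) : 0 < R1 K := by
  obtain ⟨x, hx, hne⟩ := hnt.exists_ne 0
  exact (norm_pos_iff.2 hne).trans_le ((norm_le_sum_abs x).trans (sum_abs_le_R1 hK hx))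

end Entropy

/-! ### The function `g_0`, the regions, and optimal vertices. -/

section Dual

variable {n r : ℕ} {K : Set (E n)} {c : E n} {B : Matrix (Fin r) (Fin n) ℝ}

theorem g_zero_le (hK : IsCompact K) (u : E r) {x : E n} (hx : x ∈ K) :
    g K c B 0 u ≤ quad (B.transpose * B) c x + 1 / 2 * ‖u - act B x‖ ^ 2 := by
  rw [← half_norm_sq_add_inner_cost, g]
  have h : sInf ((fun x => (inner ℝ (cost c B u) x : ℝ) - 0 * entropy x) '' K) ≤
      inner ℝ (cost c B u) x :=
    csInf_le (hK.bddBelow_image (Continuous.continuousOn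
      (by simp only [zero_mul, sub_zero]; fun_prop))) ⟨x, hx, by simp⟩
  linarith

theorem le_g_zero (hne : K.Nonempty) {u : E r} {a : ℝ}
    (h : ∀ x ∈ K, a ≤ quad (B.transpose * B) c x + 1 / 2 * ‖u - act B x‖ ^ 2) :
    a ≤ g K c B 0 u := by
  rw [g, ← sub_le_iff_le_add']
  refine le_csInf (hne.image _) ?_
  rintro _ ⟨x, hx, rfl⟩
  have := h x hx
  rw [← half_norm_sq_add_inner_cost] at this
  simp only [zero_mul, sub_zero]
  linarith

theorem inner_cost_le_of_mem_region (hhull : convexHull ℝ (vertices K) = K) {v : E n} {u : E r}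
    (hu : u ∈ region K c B v) {x : E n} (hx : x ∈ K) :
    (inner ℝ (cost c B u) v : ℝ) ≤ inner ℝ (cost c B u) x := by
  rw [← hhull] at hx
  have hconv : Convex ℝ {x : E n | (inner ℝ (cost c B u) v : ℝ) ≤ inner ℝ (cost c B u) x} :=
    convex_halfSpace_ge (innerₗ (E n) (cost c B u)).isLinear _
  exact convexHull_min (fun w hw => hu w hw) hconv hx

theorem g_zero_eq (hK : IsCompact K) (hhull : convexHull ℝ (vertices K) = K) {v : E n}
    (hv : v ∈ K) {u : E r} (hu : u ∈ region K c B v) :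
    g K c B 0 u = quad (B.transpose * B) c v + 1 / 2 * ‖u - act B v‖ ^ 2 := by
  refine (g_zero_le hK u hv).antisymm (le_g_zero ⟨v, hv⟩ fun x hx => ?_)
  rw [← half_norm_sq_add_inner_cost, ← half_norm_sq_add_inner_cost]
  have := inner_cost_le_of_mem_region hhull hu hx
  linarith

theorem vertices_nonempty (hhull : convexHull ℝ (vertices K) = K) (hne : K.Nonempty) :
    (vertices K).Nonempty := by
  rw [← hhull] at hne
  exact convexHull_nonempty_iff.1 hne

theorem exists_mem_region (hfin : (vertices K).Finite) (hvne : (vertices K).Nonempty) (u : E r) :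
    ∃ v ∈ vertices K, u ∈ region K c B v := by
  obtain ⟨v, hv, h⟩ := Set.exists_min_image (vertices K)
    (fun v => (inner ℝ (cost c B u) v : ℝ)) hfin hvne
  exact ⟨v, hv, h⟩

theorem isClosed_region (v : E n) : IsClosed (region K c B v) := by
  have h : region K c B v =
      ⋂ w ∈ vertices K, {u | (inner ℝ (cost c B u) v : ℝ) ≤ inner ℝ (cost c B u) w} := by
    ext u; simp [region]
  rw [h]
  refine isClosed_biInter fun w _ => ?_
  simp only [inner_cost]
  exact isClosed_le (by fun_prop) (by fun_prop)

/-- On the region, `g_0(u)` exceeds `f(v)` by `½‖u - Bv‖²`, while `g_0(Bv) ≤ f(v)`. -/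
theorem eq_act_of_isMin (hK : IsCompact K) (hhull : convexHull ℝ (vertices K) = K) {v : E n}
    (hv : v ∈ K) {u : E r} (hu : u ∈ region K c B v) (hmin : ∀ u', g K c B 0 u ≤ g K c B 0 u') :
    u = act B v := by
  have h1 := g_zero_eq hK hhull hv hu
  have h2 := g_zero_le (c := c) (B := B) hK (act B v) hv
  have h3 := hmin (act B v)
  rw [sub_self, norm_zero] at h2
  have h4 : ‖u - act B v‖ ^ 2 ≤ 0 := by linarith
  have h5 : ‖u - act B v‖ = 0 := pow_eq_zero_iff (two_ne_zero) |>.1 (h4.antisymm (sq_nonneg _))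
  exact sub_eq_zero.1 (norm_eq_zero.1 h5)

theorem act_mem_region_of_mem_optVertices (hK : IsCompact K)
    (hhull : convexHull ℝ (vertices K) = K) {v : E n} (hv : v ∈ optVertices K c B) :
    act B v ∈ region K c B v ∧ ∀ u', g K c B 0 (act B v) ≤ g K c B 0 u' := by
  obtain ⟨hv, u, hu, hmin⟩ := hv
  rw [← eq_act_of_isMin hK hhull hv.1 hu hmin]
  exact ⟨hu, hmin⟩

theorem g_zero_act_of_mem_optVertices (hK : IsCompact K)
    (hhull : convexHull ℝ (vertices K) = K) {v : E n} (hv : v ∈ optVertices K c B) :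
    g K c B 0 (act B v) = quad (B.transpose * B) c v := by
  rw [g_zero_eq hK hhull hv.1.1 (act_mem_region_of_mem_optVertices hK hhull hv).1]
  simp

theorem quad_le_g_zero (hK : IsCompact K) (hhull : convexHull ℝ (vertices K) = K) {v : E n}
    (hv : v ∈ optVertices K c B) (u : E r) : quad (B.transpose * B) c v ≤ g K c B 0 u := by
  rw [← g_zero_act_of_mem_optVertices hK hhull hv]
  exact (act_mem_region_of_mem_optVertices hK hhull hv).2 u

theorem quad_le_of_mem_optVertices (hK : IsCompact K) (hhull : convexHull ℝ (vertices K) = K)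
    {v : E n} (hv : v ∈ optVertices K c B) {x : E n} (hx : x ∈ K) :
    quad (B.transpose * B) c v ≤ quad (B.transpose * B) c x := by
  refine (quad_le_g_zero hK hhull hv (act B x)).trans ((g_zero_le hK _ hx).trans ?_)
  simp

theorem iInf_g_zero (hK : IsCompact K) (hhull : convexHull ℝ (vertices K) = K) {v : E n}
    (hv : v ∈ optVertices K c B) : ⨅ u, g K c B 0 u = quad (B.transpose * B) c v := by
  refine le_antisymm ?_ (le_ciInf (quad_le_g_zero hK hhull hv))
  rw [← g_zero_act_of_mem_optVertices hK hhull hv]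
  exact ciInf_le ⟨_, by rintro _ ⟨u, rfl⟩; exact quad_le_g_zero hK hhull hv u⟩ _

theorem optVertices_nonempty (hK : IsCompact K) (hhull : convexHull ℝ (vertices K) = K)
    (hfin : (vertices K).Finite) (hne : K.Nonempty) : (optVertices K c B).Nonempty := by
  -- For a minimizer `x` of `f`, the point `Bx` minimizes `g_0`; any vertex whose region contains it
  -- will do.
  obtain ⟨x, hx, hmin⟩ := hK.exists_isMinOn hne
    (continuous_quad (B.transpose * B) c).continuousOn
  obtain ⟨v, hv, hu⟩ := exists_mem_region (c := c) (B := B) hfin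
    (vertices_nonempty hhull hne) (act B x)
  refine ⟨v, hv, act B x, hu, fun u' => ?_⟩
  have h1 := g_zero_le (c := c) (B := B) hK (act B x) hx
  rw [sub_self, norm_zero] at h1
  refine h1.trans (le_g_zero hne fun y hy => ?_)
  have h2 : quad (B.transpose * B) c x ≤ quad (B.transpose * B) c y := hmin hy
  have h3 := sq_nonneg ‖u' - act B y‖
  linarith

/-- A vertex is optimal as soon as its region contains a point where `g_0` exceeds its minimum
by less than `alpha`. -/
theorem mem_optVertices_of_lt_alpha (hK : IsCompact K) (hhull : convexHull ℝ (vertices K) = K)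
    {v w : E n} (hv : v ∈ optVertices K c B) (hw : w ∈ vertices K) {u : E r}
    (hu : u ∈ region K c B w)
    (h : ((g K c B 0 u - quad (B.transpose * B) c v : ℝ) : EReal) < alpha K c B) :
    w ∈ optVertices K c B := by
  by_contra hwo
  refine absurd h (not_lt.2 ?_)
  rw [alpha, iInf_g_zero hK hhull hv, EReal.coe_sub]
  refine EReal.sub_le_sub (iInf₂_le u ?_) le_rfl
  simp only [mem_iUnion]
  exact ⟨w, ⟨hw, hwo⟩, hu⟩

/-- The cost gap `(c - Bᵀ B v)ᵀ (w - v)` is nonnegative, and vanishes only if `w` has the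
same image and the same linear cost as `v`. -/
theorem act_eq_of_gap_eq_zero (hK : IsCompact K) (hhull : convexHull ℝ (vertices K) = K)
    {v w : E n} (hv : v ∈ optVertices K c B) (hw : w ∈ K)
    (h : (inner ℝ (cost c B (act B v)) w : ℝ) = inner ℝ (cost c B (act B v)) v) :
    act B w = act B v ∧ (inner ℝ c w : ℝ) = inner ℝ c v := by
  obtain ⟨hu, hmin⟩ := act_mem_region_of_mem_optVertices hK hhull hv
  -- A tie makes `w` optimal for the cost at `Bv` too, so this minimizer of `g_0` must also equal
  -- `Bw`.
  have hu' : act B v ∈ region K c B w := fun z hz => h.trans_le (hu z hz)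
  have heq := eq_act_of_isMin hK hhull hw hu' hmin
  refine ⟨heq.symm, ?_⟩
  rw [inner_cost, inner_cost, ← heq] at h
  linarith

/-- Vertices tied with `v` at `Bv` are tied for every `u`; the finitely many strict inequalities
persist nearby. -/
theorem act_mem_interior_region (hK : IsCompact K) (hhull : convexHull ℝ (vertices K) = K)
    (hfin : (vertices K).Finite) {v : E n} (hv : v ∈ optVertices K c B) :
    act B v ∈ interior (region K c B v) := by
  have hu := (act_mem_region_of_mem_optVertices hK hhull hv).1
  have key : ∀ᶠ u in nhds (act B v), ∀ w ∈ vertices K,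
      (inner ℝ (cost c B u) v : ℝ) ≤ inner ℝ (cost c B u) w := by
    rw [Filter.eventually_all_finite hfin]
    intro w hw
    rcases (hu w hw).eq_or_lt with h | h
    · obtain ⟨h1, h2⟩ := act_eq_of_gap_eq_zero hK hhull hv hw.1 h.symm
      refine Filter.Eventually.of_forall fun u => ?_
      rw [inner_cost, inner_cost, h1, h2]
    · simp only [inner_cost] at h ⊢
      exact (ContinuousAt.eventually_lt (Continuous.continuousAt (by fun_prop))
        (Continuous.continuousAt (by fun_prop)) h).mono fun _ h => h.le
  exact mem_interior_iff_mem_nhds.2 key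

theorem gammaAt_pos (hK : IsCompact K) (hhull : convexHull ℝ (vertices K) = K)
    (hfin : (vertices K).Finite) {v : E n} (hv : v ∈ optVertices K c B) :
    0 < gammaAt K c B v := by
  rw [gammaAt, Metric.infEDist_pos_iff_notMem_closure, isClosed_frontier.closure_eq]
  exact fun h => h.2 (act_mem_interior_region hK hhull hfin hv)

/-- A point that is closer to `x ∈ interior s` than the frontier of `s` belongs to `s`. -/
theorem mem_of_edist_lt_infEDist_frontier {F : Type*} [NormedAddCommGroup F] [NormedSpace ℝ F]
    {s : Set F} {x y : F} (hx : x ∈ interior s)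
    (hxy : edist x y < Metric.infEDist x (frontier s)) : y ∈ s := by
  by_contra hy
  have hconn : IsPreconnected (segment ℝ x y) := (convex_segment x y).isPreconnected
  obtain ⟨z, hz, hzf⟩ : (segment ℝ x y ∩ frontier s).Nonempty := by
    by_contra hempty
    have hnf : ∀ z ∈ segment ℝ x y, z ∈ interior s ∨ z ∉ closure s := by
      intro z hz
      by_contra! h
      exact hempty ⟨z, hz, h.2, h.1⟩
    have hy' : y ∈ (closure s)ᶜ :=
      (hnf y (right_mem_segment ℝ x y)).resolve_left fun h => hy (interior_subset h)
    obtain ⟨z, -, hz1, hz2⟩ := hconn (interior s) (closure s)ᶜ isOpen_interior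
      isClosed_closure.isOpen_compl hnf ⟨x, left_mem_segment ℝ x y, hx⟩
      ⟨y, right_mem_segment ℝ x y, hy'⟩
    exact hz2 (subset_closure (interior_subset hz1))
  have h1 : Metric.infEDist x (frontier s) ≤ edist x z := Metric.infEDist_le_edist_of_mem hzf
  have h2 : edist x z ≤ edist x y := by
    rw [edist_dist, edist_dist]
    refine ENNReal.ofReal_le_ofReal ?_
    have := dist_add_dist_of_mem_segment hz
    linarith [dist_nonneg (x := z) (y := y)]
  exact absurd hxy (not_lt.2 (h1.trans h2))

/-- Moving from `Bv` towards `Bw` by `t < γ_v` stays in the region, so `v` still costs no more than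
`w`; but the move lowers the gap by exactly `t‖Bw - Bv‖`. -/
theorem mul_norm_le_gap (hK : IsCompact K) (hhull : convexHull ℝ (vertices K) = K)
    (hfin : (vertices K).Finite) {v w : E n} (hv : v ∈ optVertices K c B) (hw : w ∈ vertices K)
    {t : ℝ} (ht0 : 0 ≤ t) (ht : ENNReal.ofReal t < gammaAt K c B v) :
    t * ‖act B w - act B v‖ ≤
      (inner ℝ (cost c B (act B v)) w : ℝ) - inner ℝ (cost c B (act B v)) v := by
  set e := act B w - act B v with he
  rcases eq_or_ne e 0 with h0 | h0
  · rw [h0, norm_zero, mul_zero, sub_nonneg]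
    exact (act_mem_region_of_mem_optVertices hK hhull hv).1 w hw
  have hn : ‖e‖ ≠ 0 := norm_ne_zero_iff.2 h0
  have hmem : act B v + (t / ‖e‖) • e ∈ region K c B v := by
    refine mem_of_edist_lt_infEDist_frontier (act_mem_interior_region hK hhull hfin hv) ?_
    rw [edist_dist, dist_self_add_right, norm_smul, norm_div, norm_norm,
      div_mul_cancel₀ _ hn, Real.norm_of_nonneg ht0]
    exact ht
  have h := hmem w hw
  simp only [inner_cost, inner_add_left, real_inner_smul_left] at h ⊢
  have h2 : (inner ℝ e (act B w) : ℝ) - inner ℝ e (act B v) = ‖e‖ ^ 2 := by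
    rw [← inner_sub_right, ← he, real_inner_self_eq_norm_sq]
  have h3 : t / ‖e‖ * ‖e‖ ^ 2 = t * ‖e‖ := by field_simp
  have h4 : t / ‖e‖ * (inner ℝ e (act B w) - inner ℝ e (act B v)) = t * ‖e‖ := by rw [h2, h3]
  linarith

end Dual

/-- Strict bounds survive a finite infimum; `a < ⊤` covers the empty one. -/
theorem lt_biInf_of_finite {α ι : Type*} [CompleteLinearOrder α] {s : Set ι} (hs : s.Finite)
    {f : ι → α} {a : α} (ha : a < ⊤) (h : ∀ i ∈ s, a < f i) : a < ⨅ i ∈ s, f i := by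
  have : ⨅ i ∈ s, f i = hs.toFinset.inf f := by
    rw [Finset.inf_eq_iInf]; simp
  rw [this, Finset.lt_inf_iff ha]
  exact fun i hi => h i (hs.mem_toFinset.1 hi)

/-! ### Positivity and finiteness of `α`, `γ` and `Δ`. -/

section Constants

variable {n r : ℕ} {K : Set (E n)} {c : E n} {B : Matrix (Fin r) (Fin n) ℝ}

theorem finite_optVertices (hfin : (vertices K).Finite) : (optVertices K c B).Finite :=
  hfin.subset fun _ h => h.1

/-- On a nonempty region `g_0` is least at the point nearest to `Bv`, so its minimum is attained;
for a nonoptimal vertex it lies strictly above the global minimum. -/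
theorem alpha_pos (hK : IsCompact K) (hhull : convexHull ℝ (vertices K) = K)
    (hfin : (vertices K).Finite) (hne : K.Nonempty) : 0 < alpha K c B := by
  obtain ⟨v₀, hv₀⟩ := optVertices_nonempty (c := c) (B := B) hK hhull hfin hne
  set q := quad (B.transpose * B) c v₀ with hq
  -- Finiteness of the vertex set provides one level `a > q` below `g_0` on all these regions at
  -- once.
  have key : ∀ᶠ a in nhdsWithin q (Ioi q), ∀ v ∈ vertices K \ optVertices K c B,
      ∀ u ∈ region K c B v, a ≤ g K c B 0 u := by
    rw [Filter.eventually_all_finite hfin.sdiff]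
    rintro v ⟨hv, hvo⟩
    rcases (region K c B v).eq_empty_or_nonempty with he | hn
    · simp [he]
    obtain ⟨u₀, hu₀, hdist⟩ := (isClosed_region v).exists_infDist_eq_dist hn (act B v)
    have hlt : q < g K c B 0 u₀ := by
      refine lt_of_le_of_ne (quad_le_g_zero hK hhull hv₀ u₀) fun h => hvo ⟨hv, u₀, hu₀, ?_⟩
      intro u'
      exact h ▸ quad_le_g_zero hK hhull hv₀ u'
    filter_upwards [Ioc_mem_nhdsGT hlt] with a ha u hu
    refine ha.2.trans ?_
    rw [g_zero_eq hK hhull hv.1 hu₀, g_zero_eq hK hhull hv.1 hu]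
    have h : ‖u₀ - act B v‖ ≤ ‖u - act B v‖ := by
      rw [← dist_eq_norm, ← dist_eq_norm, dist_comm u₀, dist_comm u, ← hdist]
      exact Metric.infDist_le_dist_of_mem hu
    gcongr
  obtain ⟨a, ha, haq⟩ := (key.and self_mem_nhdsWithin).exists
  have haq : q < a := haq
  rw [alpha, iInf_g_zero hK hhull hv₀, ← hq]
  refine lt_of_lt_of_le (b := ((a : EReal) - (q : EReal))) ?_ (EReal.sub_le_sub ?_ le_rfl)
  · rw [← EReal.coe_sub]
    exact_mod_cast sub_pos.2 haq
  · refine le_iInf₂ fun u hu => ?_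
    simp only [mem_iUnion] at hu
    obtain ⟨v, hv, hu⟩ := hu
    exact_mod_cast ha v hv u hu

theorem gamma_pos (hK : IsCompact K) (hhull : convexHull ℝ (vertices K) = K)
    (hfin : (vertices K).Finite) : 0 < gamma K c B :=
  lt_biInf_of_finite (finite_optVertices hfin) ENNReal.zero_lt_top
    fun _ hv => gammaAt_pos hK hhull hfin hv

theorem kappa_eq {d v : E n} (hv : v ∈ lpArgmin K d) :
    kappa K d = (⨅ w ∈ vertices K \ lpArgmin K d, ((inner ℝ d w : ℝ) : EReal))
      - ((inner ℝ d v : ℝ) : EReal) := by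
  have h : (fun y => (inner ℝ d y : ℝ)) '' lpArgmin K d = {(inner ℝ d v : ℝ)} := by
    refine Set.eq_singleton_iff_unique_mem.2 ⟨⟨v, hv, rfl⟩, ?_⟩
    rintro _ ⟨w, hw, rfl⟩
    exact le_antisymm (hw.2 hv.1) (hv.2 hw.1)
  rw [kappa, h, csInf_singleton]

theorem kappa_pos (hfin : (vertices K).Finite) {d v : E n} (hv : v ∈ lpArgmin K d) :
    0 < kappa K d := by
  rw [kappa_eq hv]
  refine EReal.sub_pos.2 (lt_biInf_of_finite hfin.sdiff (EReal.coe_lt_top _) ?_)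
  rintro w ⟨hw, hwo⟩
  refine EReal.coe_lt_coe_iff.2 (lt_of_not_ge fun h => hwo ⟨hw.1, fun y hy => ?_⟩)
  exact h.trans (hv.2 hy)

theorem kappa_le {d v w : E n} (hv : v ∈ lpArgmin K d) (hw : w ∈ vertices K)
    (hne : (inner ℝ d w : ℝ) ≠ inner ℝ d v) :
    kappa K d ≤ ((inner ℝ d w - inner ℝ d v : ℝ) : EReal) := by
  rw [kappa_eq hv, EReal.coe_sub]
  refine EReal.sub_le_sub (iInf₂_le w ⟨hw, fun h => hne ?_⟩) le_rfl
  exact le_antisymm (h.2 hv.1) (hv.2 hw.1)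

theorem mem_lpArgmin_of_mem_optVertices (hK : IsCompact K)
    (hhull : convexHull ℝ (vertices K) = K) {v : E n} (hv : v ∈ optVertices K c B) :
    v ∈ lpArgmin K (cost c B (act B v)) :=
  ⟨hv.1.1, fun _ hx => inner_cost_le_of_mem_region hhull
    (act_mem_region_of_mem_optVertices hK hhull hv).1 hx⟩

theorem delta_pos (hK : IsCompact K) (hhull : convexHull ℝ (vertices K) = K)
    (hfin : (vertices K).Finite) : 0 < delta K c B := by
  refine lt_biInf_of_finite (finite_optVertices hfin) EReal.zero_lt_top fun v hv => ?_
  refine lt_min (kappa_pos hfin (mem_lpArgmin_of_mem_optVertices hK hhull hv)) ?_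
  refine EReal.coe_ennreal_pos.2 (ENNReal.mul_pos ?_ ?_)
  · exact (ENNReal.div_pos (gammaAt_pos hK hhull hfin hv).ne' ENNReal.ofNat_ne_top).ne'
  · refine (lt_biInf_of_finite (hfin.subset fun _ h => h.1) ENNReal.zero_lt_top ?_).ne'
    rintro w ⟨-, hw⟩
    rw [enorm_pos]
    exact sub_ne_zero.2 hw

theorem delta_le_gap (hK : IsCompact K) (hhull : convexHull ℝ (vertices K) = K) {v w : E n}
    (hv : v ∈ optVertices K c B) (hw : w ∈ vertices K)
    (hne : (inner ℝ (cost c B (act B v)) w : ℝ) ≠ inner ℝ (cost c B (act B v)) v) :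
    delta K c B ≤ ((inner ℝ (cost c B (act B v)) w - inner ℝ (cost c B (act B v)) v : ℝ) : EReal) :=
  (iInf₂_le v hv).trans ((min_le_left _ _).trans
    (kappa_le (mem_lpArgmin_of_mem_optVertices hK hhull hv) hw hne))

/-- If all vertices tied with `v` for the cost at `Bv`, all of `K` would share its image and linear
cost, making `f` constant. A vertex that is not tied bounds `Δ` by its gap. -/
theorem delta_ne_top (hK : IsCompact K) (hhull : convexHull ℝ (vertices K) = K)
    (hfin : (vertices K).Finite) (hne : K.Nonempty)
    (hnc : ∃ x ∈ K, ∃ y ∈ K, quad (B.transpose * B) c x ≠ quad (B.transpose * B) c y) :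
    delta K c B ≠ ⊤ := by
  obtain ⟨v, hv⟩ := optVertices_nonempty (c := c) (B := B) hK hhull hfin hne
  have : ∃ w ∈ vertices K,
      (inner ℝ (cost c B (act B v)) w : ℝ) ≠ inner ℝ (cost c B (act B v)) v := by
    by_contra! h
    have hlin : ∀ x ∈ K,
        (inner ℝ (cost c B (act B v)) x : ℝ) = inner ℝ (cost c B (act B v)) v := by
      intro x hx
      rw [← hhull] at hx
      exact convexHull_min (t := {x | (inner ℝ (cost c B (act B v)) x : ℝ) = _}) h
        (convex_hyperplane (innerₗ (E n) (cost c B (act B v))).isLinear _) hx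
    have hconst : ∀ x ∈ K, quad (B.transpose * B) c x = quad (B.transpose * B) c v := by
      intro x hx
      obtain ⟨h1, h2⟩ := act_eq_of_gap_eq_zero hK hhull hv hx (hlin x hx)
      rw [quad_gram, quad_gram, h1, h2]
    obtain ⟨x, hx, y, hy, hxy⟩ := hnc
    exact hxy ((hconst x hx).trans (hconst y hy).symm)
  obtain ⟨w, hw, hwne⟩ := this
  exact ((delta_le_gap hK hhull hv hw hwne).trans_lt (EReal.coe_lt_top _)).ne

/-- If `B w ≠ B v`, then `γ_v` is finite and controls both the gap of `w` and `Δ`. -/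
theorem exists_gammaAt_eq (hK : IsCompact K) (hhull : convexHull ℝ (vertices K) = K)
    (hfin : (vertices K).Finite) {v w : E n} (hv : v ∈ optVertices K c B) (hw : w ∈ vertices K)
    (hne : act B w ≠ act B v) :
    ∃ t : ℝ, 0 ≤ t ∧ gammaAt K c B v = ENNReal.ofReal t ∧
      t * ‖act B w - act B v‖ ≤
        (inner ℝ (cost c B (act B v)) w : ℝ) - inner ℝ (cost c B (act B v)) v ∧
      delta K c B ≤ ((t / 2 * ‖act B w - act B v‖ : ℝ) : EReal) := by
  set D := (inner ℝ (cost c B (act B v)) w : ℝ) - inner ℝ (cost c B (act B v)) v with hD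
  have hn : 0 < ‖act B w - act B v‖ := norm_pos_iff.2 (sub_ne_zero.2 hne)
  have hbound : ∀ t : ℝ, 0 ≤ t → ENNReal.ofReal t < gammaAt K c B v →
      t ≤ D / ‖act B w - act B v‖ := fun t ht0 ht =>
    (le_div_iff₀ hn).2 (mul_norm_le_gap hK hhull hfin hv hw ht0 ht)
  have hle : gammaAt K c B v ≤ ENNReal.ofReal (D / ‖act B w - act B v‖) := by
    -- The gap bound holds only for radii strictly below `γ_v`, so it is passed to the supremum.
    refine le_of_forall_lt fun s hs => ?_
    obtain ⟨s', hs', hs''⟩ := exists_between hs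
    have hs'top : s' ≠ ⊤ := (hs''.trans_le le_top).ne
    refine hs'.trans_le ?_
    rw [← ENNReal.ofReal_toReal hs'top] at hs'' ⊢
    exact ENNReal.ofReal_le_ofReal (hbound _ ENNReal.toReal_nonneg hs'')
  have htop : gammaAt K c B v ≠ ⊤ := (hle.trans_lt ENNReal.ofReal_lt_top).ne
  have hD0 : 0 ≤ D / ‖act B w - act B v‖ :=
    hbound 0 le_rfl (by simpa using gammaAt_pos hK hhull hfin hv)
  refine ⟨(gammaAt K c B v).toReal, ENNReal.toReal_nonneg, (ENNReal.ofReal_toReal htop).symm,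
    (le_div_iff₀ hn).1 (ENNReal.toReal_le_of_le_ofReal hD0 hle), ?_⟩
  refine (iInf₂_le v hv).trans ((min_le_right _ _).trans ?_)
  have h1 : gammaAt K c B v / 2 * ⨅ w ∈ {w | w ∈ vertices K ∧ act B w ≠ act B v},
      ‖act B w - act B v‖ₑ ≤
      ENNReal.ofReal ((gammaAt K c B v).toReal / 2 * ‖act B w - act B v‖) := by
    rw [ENNReal.ofReal_mul (by positivity), ofReal_norm, ENNReal.ofReal_div_of_pos two_pos,
      ENNReal.ofReal_toReal htop, ENNReal.ofReal_ofNat]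
    gcongr
    exact iInf₂_le w ⟨hw, hne⟩
  refine (EReal.coe_ennreal_le_coe_ennreal_iff.2 h1).trans_eq ?_
  rw [EReal.coe_ennreal_ofReal, max_eq_left (by positivity)]

end Constants

/-! ### From the entropy inequality to an exponentially small weight. -/

section Weight

theorem weight_le_exp {t D ε R H : ℝ} (ht : 0 < t) (hε : 0 < ε) (hR : 0 < R)
    (h : t * D ≤ ε * (t * H + R * (Real.negMulLog t + t))) :
    t ≤ Real.exp (-D / (ε * R) + (R + H) / R) := by
  have h1 : D ≤ ε * (H + R * (1 - Real.log t)) := by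
    refine le_of_mul_le_mul_left (h.trans_eq ?_) ht
    rw [Real.negMulLog]; ring
  rw [← Real.log_le_iff_le_exp ht]
  have h2 : -D / (ε * R) + (R + H) / R - Real.log t =
      (ε * (H + R * (1 - Real.log t)) - D) / (ε * R) := by
    field_simp; ring
  have h3 : 0 ≤ (ε * (H + R * (1 - Real.log t)) - D) / (ε * R) :=
    div_nonneg (by linarith) (by positivity)
  linarith

/-- The function `s ↦ s exp(-s / (εR))` decreases for `s ≥ εR`, and `δ ≥ ε(R + H)` lies in that
range; so the actual gap `D` may be replaced by `δ` even after multiplication by it. -/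
theorem weight_le_and_weight_mul_le {t D δ ε R H : ℝ} (hε : 0 < ε) (hR : 0 < R)
    (hH : 0 ≤ H) (hδ : 0 < δ) (hδD : δ ≤ D) (hεδ : ε * (R + H) ≤ δ)
    (h : t ≤ Real.exp (-D / (ε * R) + (R + H) / R)) :
    t ≤ Real.exp (-δ / (ε * R) + (R + H) / R) ∧
      t * D ≤ Real.exp (-δ / (ε * R) + (R + H) / R) * δ := by
  refine ⟨h.trans (Real.exp_le_exp.2 (by gcongr)), ?_⟩
  have h1 : -D / (ε * R) + (R + H) / R ≤ (-δ / (ε * R) + (R + H) / R) + (1 - D / δ) := by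
    have h2 : (D - δ) / δ ≤ (D - δ) / (ε * R) := by
      gcongr
      nlinarith [mul_nonneg hε.le hH]
    have h3 : (D - δ) / δ = D / δ - 1 := by field_simp
    have h4 : (D - δ) / (ε * R) = -δ / (ε * R) - -D / (ε * R) := by ring
    linarith
  -- This is `s ≤ exp(s - 1)` at `s = D / δ`.
  have h5 : Real.exp (1 - D / δ) * D ≤ δ := by
    have h6 := Real.add_one_le_exp (D / δ - 1)
    have h7 : D ≤ Real.exp (D / δ - 1) * δ := by
      rw [← div_le_iff₀ hδ]; linarith
    calc Real.exp (1 - D / δ) * D ≤ Real.exp (1 - D / δ) * (Real.exp (D / δ - 1) * δ) := by gcongr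
      _ = δ := by rw [← mul_assoc, ← Real.exp_add]; simp
  calc t * D ≤ Real.exp ((-δ / (ε * R) + (R + H) / R) + (1 - D / δ)) * D := by
        have : 0 ≤ D := hδ.le.trans hδD
        gcongr
        exact h.trans (Real.exp_le_exp.2 h1)
    _ = Real.exp (-δ / (ε * R) + (R + H) / R) * (Real.exp (1 - D / δ) * D) := by
        rw [Real.exp_add]; ring
    _ ≤ _ := by gcongr

end Weight

/-! ### Localizing the regularized solution and bounding its error. -/

section Solution

variable {n r : ℕ} {K : Set (E n)} {c : E n} {B : Matrix (Fin r) (Fin n) ℝ} {ε : ℝ}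

/-- A solution of the regularized quadratic problem solves the regularized linear program whose
cost is the gradient of the quadratic objective at that solution. -/
theorem IsSolution.inner_cost_sub_le {x y : E n} (hx : IsSolution K (B.transpose * B) c ε x)
    (hy : y ∈ K) :
    (inner ℝ (cost c B (act B x)) x : ℝ) - inner ℝ (cost c B (act B x)) y ≤
      ε * (entropy x - entropy y) := by
  have h : quad (B.transpose * B) c x - ε * entropy x ≤
      quad (B.transpose * B) c y - ε * entropy y := hx.2 hy
  have h1 := half_norm_sq_add_inner_cost c B (act B x) x
  have h2 := half_norm_sq_add_inner_cost c B (act B x) y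
  rw [sub_self, norm_zero] at h1
  -- Concavity enters here: `f(y)` lies below its linearization at `x` by half this square.
  have h3 := sq_nonneg ‖act B x - act B y‖
  linarith

theorem IsSolution.exists_optVertex (hK : IsCompact K) (hhull : convexHull ℝ (vertices K) = K)
    (hfin : (vertices K).Finite) (hε : 0 < ε) (hRH : 0 < RH K)
    (hα : (ε : EReal) < alpha K c B / (RH K : EReal))
    (hγ : (ε : EReal) < (gamma K c B : EReal) ^ 2 / ((8 * RH K : ℝ) : EReal))
    {x : E n} (hx : IsSolution K (B.transpose * B) c ε x) :
    ∃ v ∈ optVertices K c B, ENNReal.ofReal (2 * ‖act B x - act B v‖) < gammaAt K c B v := by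
  have hne : K.Nonempty := ⟨x, hx.1⟩
  rw [EReal.lt_div_iff (EReal.coe_pos.2 hRH) (EReal.coe_ne_top _), ← EReal.coe_mul] at hα
  rw [EReal.lt_div_iff (EReal.coe_pos.2 (by positivity)) (EReal.coe_ne_top _),
    ← EReal.coe_mul, ← EReal.coe_ennreal_pow] at hγ
  have hgap : ∀ v ∈ K, g K c B 0 (act B x) - quad (B.transpose * B) c v ≤ ε * RH K := by
    intro v hv
    have h1 := g_zero_le (c := c) (B := B) hK (act B x) hx.1
    rw [sub_self, norm_zero] at h1
    have h2 : quad (B.transpose * B) c x - ε * entropy x ≤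
        quad (B.transpose * B) c v - ε * entropy v := hx.2 hv
    have h3 := mul_le_mul_of_nonneg_left (entropy_sub_le_RH hK hx.1 hv) hε.le
    linarith
  obtain ⟨v₀, hv₀⟩ := optVertices_nonempty (c := c) (B := B) hK hhull hfin hne
  obtain ⟨v, hv, hu⟩ := exists_mem_region (c := c) (B := B) hfin
    (vertices_nonempty hhull hne) (act B x)
  have hvo : v ∈ optVertices K c B := mem_optVertices_of_lt_alpha hK hhull hv₀ hv hu
    ((EReal.coe_le_coe_iff.2 (hgap v₀ hv₀.1.1)).trans_lt hα)
  -- Otherwise `γ² ≤ 4‖Bx - Bv‖² ≤ 8εH`, against the bound on `ε`.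
  refine ⟨v, hvo, lt_of_not_ge fun hle => absurd hγ (not_lt.2 ?_)⟩
  have h1 := hgap v hv.1
  rw [g_zero_eq hK hhull hv.1 hu] at h1
  have h2 : gamma K c B ^ 2 ≤ ENNReal.ofReal ((2 * ‖act B x - act B v‖) ^ 2) := by
    rw [ENNReal.ofReal_pow (by positivity)]
    gcongr
    exact (iInf₂_le v hvo).trans hle
  refine (EReal.coe_ennreal_le_coe_ennreal_iff.2 h2).trans ?_
  rw [EReal.coe_ennreal_ofReal, max_eq_left (by positivity), EReal.coe_le_coe_iff]
  linarith

/-- Near `B v`, every vertex is either indistinguishable from `v` or worse than `v` by at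
least `Δ`. -/
theorem act_eq_or_delta_le (hK : IsCompact K) (hhull : convexHull ℝ (vertices K) = K)
    (hfin : (vertices K).Finite) {v w : E n} (hv : v ∈ optVertices K c B) (hw : w ∈ vertices K)
    {u : E r} (hu : ENNReal.ofReal (2 * ‖u - act B v‖) < gammaAt K c B v) :
    (act B w = act B v ∧ (inner ℝ c w : ℝ) = inner ℝ c v) ∨
      delta K c B ≤ ((inner ℝ (cost c B u) w - inner ℝ (cost c B u) v : ℝ) : EReal) := by
  by_cases hB : act B w = act B v
  · by_cases hc : (inner ℝ c w : ℝ) = inner ℝ c v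
    · exact Or.inl ⟨hB, hc⟩
    · refine Or.inr ?_
      have h := delta_le_gap hK hhull hv hw (by
        rw [inner_cost, inner_cost, hB]
        exact fun h => hc (by linarith))
      rwa [inner_cost, inner_cost, hB, sub_sub_sub_cancel_right] at h ⊢
  · refine Or.inr ?_
    obtain ⟨t, -, hγ, hgap, hδ⟩ := exists_gammaAt_eq hK hhull hfin hv hw hB
    refine hδ.trans (EReal.coe_le_coe_iff.2 ?_)
    rw [hγ] at hu
    have ht : 2 * ‖u - act B v‖ < t := (ENNReal.ofReal_lt_ofReal_iff_of_nonneg (by positivity)).1 hu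
    -- The gap at `Bv` is at least `t‖Bw - Bv‖`; moving the cost by less than `t / 2` uses up at
    -- most half of it.
    have h1 := real_inner_le_norm (u - act B v) (act B w - act B v)
    have h2 : ‖u - act B v‖ * ‖act B w - act B v‖ ≤ t / 2 * ‖act B w - act B v‖ := by
      gcongr
      linarith
    simp only [inner_cost, inner_sub_left, inner_sub_right] at h1 hgap ⊢
    linarith

theorem inner_gap_le {x v : E n} {R : ℝ} (hx : ‖x‖ ≤ R) (hv : ‖v‖ ≤ R) :
    (inner ℝ c x : ℝ) - inner ℝ c v ≤ 2 * ‖c‖ * R := by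
  rw [← inner_sub_right]
  calc (inner ℝ c (x - v) : ℝ) ≤ ‖c‖ * ‖x - v‖ := real_inner_le_norm _ _
    _ ≤ ‖c‖ * (R + R) := by
        gcongr
        exact (norm_sub_le _ _).trans (add_le_add hx hv)
    _ = _ := by ring

/-- `Δ` is at most half the gap of `w`, by the factor `γ_v / 2` in its definition; the gap is
estimated by Cauchy-Schwarz. -/
theorem delta_le_of_act_ne (hK : IsCompact K) (hhull : convexHull ℝ (vertices K) = K)
    (hfin : (vertices K).Finite) {v w : E n} (hv : v ∈ optVertices K c B) (hw : w ∈ vertices K)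
    (hne : act B w ≠ act B v) :
    delta K c B ≤ ((‖c‖ * R1 K + opNorm (B.transpose * B) * R1 K ^ 2 : ℝ) : EReal) := by
  obtain ⟨t, -, -, hgap, hδ⟩ := exists_gammaAt_eq hK hhull hfin hv hw hne
  refine hδ.trans (EReal.coe_le_coe_iff.2 ?_)
  have hvR : ‖v‖ ≤ R1 K := (norm_le_sum_abs v).trans (sum_abs_le_R1 hK hv.1.1)
  have hwR : ‖w‖ ≤ R1 K := (norm_le_sum_abs w).trans (sum_abs_le_R1 hK hw.1)
  have h1 := inner_gap_le (c := c) hwR hvR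
  have h2 := neg_le_of_abs_le (abs_inner_gram_le B v (w - v))
  have hm : 0 ≤ opNorm (B.transpose * B) := norm_nonneg _
  have h3 : opNorm (B.transpose * B) * ‖v‖ * ‖w - v‖ ≤
      opNorm (B.transpose * B) * R1 K * (R1 K + R1 K) := by
    have : ‖w - v‖ ≤ R1 K + R1 K := (norm_sub_le _ _).trans (add_le_add hwR hvR)
    have : 0 ≤ R1 K := (norm_nonneg _).trans hvR
    gcongr
  rw [map_sub, inner_sub_right] at h2
  rw [inner_cost, inner_cost] at hgap
  linarith

/-- A point of `K` is a convex combination of a point that is indistinguishable from `v` and a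
point that is worse than `v` by at least `δ`, if each vertex is of one of these two kinds. -/
theorem exists_combo (hhull : convexHull ℝ (vertices K) = K) {v : E n} (hv : v ∈ vertices K)
    {d : E n} {δ : ℝ} (h : ∀ w ∈ vertices K, (act B w = act B v ∧ (inner ℝ c w : ℝ) = inner ℝ c v) ∨
      δ ≤ (inner ℝ d w - inner ℝ d v : ℝ)) {x : E n} (hx : x ∈ K)
    (hne : act B x ≠ act B v ∨ (inner ℝ c x : ℝ) ≠ inner ℝ c v) :
    ∃ y ∈ K, ∃ z ∈ K, ∃ t : ℝ, 0 < t ∧ t ≤ 1 ∧ x = (1 - t) • y + t • z ∧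
      act B y = act B v ∧ (inner ℝ c y : ℝ) = inner ℝ c v ∧
      δ ≤ (inner ℝ d z - inner ℝ d v : ℝ) := by
  set P : Set (E n) := {w | act B w = act B v ∧ (inner ℝ c w : ℝ) = inner ℝ c v} with hP
  set Q : Set (E n) := {w | δ ≤ (inner ℝ d w - inner ℝ d v : ℝ)} with hQ
  have hPc : Convex ℝ P := by
    refine Convex.inter (s := {w | act B w = act B v}) (t := {w | (inner ℝ c w : ℝ) = inner ℝ c v})
      ?_ (convex_hyperplane (innerₗ (E n) c).isLinear _)
    exact (convex_singleton (act B v)).linear_preimage (act B)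
  have hQc : Convex ℝ Q := by
    have : Q = {w | δ + inner ℝ d v ≤ (inner ℝ d w : ℝ)} := by
      ext w; simp only [hQ, mem_ofPred_eq, le_sub_iff_add_le]
    rw [this]
    exact convex_halfSpace_ge (innerₗ (E n) d).isLinear _
  have hxP : x ∉ P := fun hxP => hne.elim (fun h => h hxP.1) (fun h => h hxP.2)
  have hsub : vertices K ⊆ (vertices K ∩ P) ∪ (vertices K ∩ Q) := fun w hw =>
    (h w hw).imp (fun h => ⟨hw, h⟩) (fun h => ⟨hw, h⟩)
  have hPne : (vertices K ∩ P).Nonempty := ⟨v, hv, rfl, rfl⟩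
  have hxh : x ∈ convexHull ℝ (vertices K) := hhull.symm ▸ hx
  have hQne : (vertices K ∩ Q).Nonempty := by
    by_contra he
    rw [not_nonempty_iff_eq_empty] at he
    rw [he, union_empty] at hsub
    exact hxP (convexHull_min (hsub.trans inter_subset_right) hPc hxh)
  have hxj := convexHull_mono hsub hxh
  rw [convexHull_union hPne hQne, mem_convexJoin] at hxj
  obtain ⟨y, hy, z, hz, s, t, hs, ht, hst, rfl⟩ := hxj
  have hyP : y ∈ P := convexHull_min inter_subset_right hPc hy
  have hzQ : z ∈ Q := convexHull_min inter_subset_right hQc hz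
  have hs1 : s = 1 - t := by linarith
  refine ⟨y, hhull ▸ convexHull_mono inter_subset_left hy, z,
    hhull ▸ convexHull_mono inter_subset_left hz, t, ht.lt_of_ne ?_, by linarith, by rw [hs1],
    hyP.1, hyP.2, hzQ⟩
  -- Weight zero on `z` would make `x` indistinguishable from `v`.
  rintro rfl
  have : s = 1 := by linarith
  apply hxP
  simpa [this] using hyP

theorem IsSolution.quad_sub_le (hK : IsCompact K) (hpos : ∀ x ∈ K, ∀ i, 0 ≤ x i)
    (hhull : convexHull ℝ (vertices K) = K) (hfin : (vertices K).Finite) (hε : 0 < ε)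
    (hRH : 0 < RH K) (hR1 : 0 < R1 K) {δ : ℝ} (hδ : delta K c B = δ) (hδ0 : 0 < δ)
    (hεδ : ε * (R1 K + RH K) ≤ δ) {x v : E n} (hx : IsSolution K (B.transpose * B) c ε x)
    (hv : v ∈ optVertices K c B)
    (hu : ENNReal.ofReal (2 * ‖act B x - act B v‖) < gammaAt K c B v) :
    quad (B.transpose * B) c x - quad (B.transpose * B) c v ≤
      max (4 * R1 K ^ 2 * opNorm (B.transpose * B)) (2 * ‖c‖ * R1 K) *
        Real.exp (-δ / (ε * R1 K) + (R1 K + RH K) / R1 K) := by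
  set m := opNorm (B.transpose * B) with hm
  set e := Real.exp (-δ / (ε * R1 K) + (R1 K + RH K) / R1 K) with he
  have he0 : 0 < e := Real.exp_pos _
  have hmax : 0 ≤ max (4 * R1 K ^ 2 * m) (2 * ‖c‖ * R1 K) := le_max_of_le_right (by positivity)
  by_cases hsame : act B x = act B v ∧ (inner ℝ c x : ℝ) = inner ℝ c v
  · rw [quad_gram, quad_gram, hsame.1, hsame.2, sub_self]
    positivity
  obtain ⟨y, hy, z, hz, t, ht0, ht1, hxyz, hyB, hyc, hzδ⟩ := exists_combo hhull hv.1
    (fun w hw => (act_eq_or_delta_le hK hhull hfin hv hw hu).imp_right fun h =>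
      EReal.coe_le_coe_iff.1 (hδ ▸ h)) hx.1 (not_and_or.1 hsame)
  set d := cost c B (act B x) with hd
  set D := (inner ℝ d z - inner ℝ d v : ℝ) with hD
  have hR : ∀ w ∈ K, ‖w‖ ≤ R1 K := fun w hw => (norm_le_sum_abs w).trans (sum_abs_le_R1 hK hw)
  have hsum : ∀ w ∈ K, ∑ i, w i ≤ R1 K := fun w hw =>
    (Finset.sum_le_sum fun i _ => le_abs_self (w i)).trans (sum_abs_le_R1 hK hw)
  have hdy : (inner ℝ d y : ℝ) = inner ℝ d v := by
    rw [hd, inner_cost, inner_cost, hyB, hyc]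
  have hdx : (inner ℝ d x : ℝ) - inner ℝ d v = t * D := by
    conv_lhs => rw [hxyz]
    rw [inner_add_right, real_inner_smul_right, real_inner_smul_right, hdy, hD]
    ring
  have hent : entropy x - entropy y ≤
      t * RH K + R1 K * (Real.negMulLog t + t) := by
    have h1 := entropy_combo_le (hpos y hy) (hpos z hz) (hsum y hy) (hsum z hz) ht0.le ht1
    rw [← hxyz] at h1
    have h2 := mul_le_mul_of_nonneg_left (entropy_sub_le_RH hK hz hy) ht0.le
    linarith
  have hweight : t * D ≤ ε * (t * RH K + R1 K * (Real.negMulLog t + t)) := by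
    have h := hx.inner_cost_sub_le hy
    rw [← hd, hdy, hdx] at h
    exact h.trans (mul_le_mul_of_nonneg_left hent hε.le)
  obtain ⟨hte, htD⟩ := weight_le_and_weight_mul_le hε hR1 hRH.le hδ0 hzδ hεδ
    (weight_le_exp ht0 hε hR1 hweight)
  rw [← he] at hte htD
  have hquad : quad (B.transpose * B) c x - quad (B.transpose * B) c v =
      t * D + 1 / 2 * (t ^ 2 * ‖act B (z - v)‖ ^ 2) := by
    have h1 := half_norm_sq_add_inner_cost c B (act B x) x
    have h2 := half_norm_sq_add_inner_cost c B (act B x) v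
    have h3 : act B x - act B v = t • act B (z - v) := by
      conv_lhs => rw [hxyz]
      rw [map_add, map_smul, map_smul, map_sub, hyB]
      module
    rw [sub_self, norm_zero] at h1
    rw [h3, norm_smul, mul_pow, Real.norm_eq_abs, sq_abs] at h2
    linarith
  rw [hquad]
  -- If some image differs, `δ` is bounded by `‖c‖` and the operator norm. Otherwise the quadratic
  -- term vanishes and `D` itself is at most `2‖c‖R`.
  by_cases hB : ∃ w ∈ vertices K, act B w ≠ act B v
  · obtain ⟨w, hw, hwB⟩ := hB
    have h1 := delta_le_of_act_ne hK hhull hfin hv hw hwB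
    rw [hδ, EReal.coe_le_coe_iff, ← hm] at h1
    have h2 : ‖act B (z - v)‖ ^ 2 ≤ m * (2 * R1 K ^ 2) := by
      rw [← real_inner_self_eq_norm_sq]
      refine (le_abs_self _).trans ((abs_inner_gram_le B _ _).trans ?_)
      rw [mul_assoc, ← sq]
      have : 0 ≤ m := norm_nonneg _
      gcongr
      exact norm_sub_sq_le (hpos z hz) (hpos v hv.1.1) (hR z hz) (hR v hv.1.1)
    have h3 : t ^ 2 * ‖act B (z - v)‖ ^ 2 ≤ e * (m * (2 * R1 K ^ 2)) := by
      have : t ^ 2 ≤ e := by nlinarith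
      gcongr
    have h4 : e * δ ≤ e * (‖c‖ * R1 K + m * R1 K ^ 2) := by gcongr
    -- The left side is the average of the two entries of the maximum.
    have h5 : ‖c‖ * R1 K + m * R1 K ^ 2 + m * R1 K ^ 2 ≤
        max (4 * R1 K ^ 2 * m) (2 * ‖c‖ * R1 K) := by
      have h6 := le_max_left (4 * R1 K ^ 2 * m) (2 * ‖c‖ * R1 K)
      have h7 := le_max_right (4 * R1 K ^ 2 * m) (2 * ‖c‖ * R1 K)
      linarith
    have h8 := mul_le_mul_of_nonneg_left h5 he0.le
    linarith
  · push Not at hB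
    have hBz : act B z = act B v := by
      have hz' := hhull.symm ▸ hz
      exact convexHull_min (t := {w | act B w = act B v}) hB
        ((convex_singleton (act B v)).linear_preimage (act B)) hz'
    have hDle : D ≤ 2 * ‖c‖ * R1 K := by
      rw [hD, hd, inner_cost, inner_cost, hBz, sub_sub_sub_cancel_right]
      exact inner_gap_le (hR z hz) (hR v hv.1.1)
    rw [map_sub, hBz, sub_self, norm_zero]
    have h1 : t * D ≤ e * max (4 * R1 K ^ 2 * m) (2 * ‖c‖ * R1 K) :=
      mul_le_mul hte (hDle.trans (le_max_right _ _)) (hδ0.le.trans hzδ) he0.le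
    linarith

end Solution

end EntropicQP

/-! ### The main theorem. -/

open EntropicQP in
theorem corollary1 {m n r : ℕ} (A : Matrix (Fin m) (Fin n) ℝ) (b : E m)
    (M : Matrix (Fin n) (Fin n) ℝ) (hM : M.PosSemidef) (c : E n)
    (B : Matrix (Fin r) (Fin n) ℝ) (hB : M = B.transpose * B)
    (K : Set (E n)) (hK : K = feasible A b)
    (hne : K.Nonempty) (hbdd : Bornology.IsBounded K)
    (hnc : ∃ x ∈ K, ∃ y ∈ K, quad M c x ≠ quad M c y) :
    -- the constants are positive and `Δ` is finite, so the range of `ε` is a nonempty interval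
    (0 < RH K ∧ 0 < R1 K ∧ 0 < alpha K c B ∧ 0 < gamma K c B ∧
      0 < delta K c B ∧ delta K c B ≠ ⊤) ∧
    ∀ ε : ℝ, 0 < ε →
      (ε : EReal) < alpha K c B / (RH K : EReal) →
      (ε : EReal) < (gamma K c B : EReal) ^ 2 / ((8 * RH K : ℝ) : EReal) →
      (ε : EReal) < delta K c B / ((R1 K + RH K : ℝ) : EReal) →
      ∀ x : E n, IsSolution K M c ε x →
        0 ≤ quad M c x - sInf (quad M c '' K) ∧
        quad M c x - sInf (quad M c '' K) ≤
          max (4 * R1 K ^ 2 * opNorm M) (2 * ‖c‖ * R1 K) *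
            Real.exp (-(delta K c B).toReal / (ε * R1 K) + (R1 K + RH K) / R1 K) := by
  subst hB hK
  have hcpt : IsCompact (feasible A b) :=
    Metric.isCompact_of_isClosed_isBounded isClosed_feasible hbdd
  have hfin := finite_vertices_feasible (A := A) (b := b)
  have hhull := convexHull_vertices_feasible hbdd
  have hpos : ∀ x ∈ feasible A b, ∀ i, 0 ≤ x i := fun x hx => hx.2
  have hnt : (feasible A b).Nontrivial := by
    obtain ⟨x, hx, y, hy, hxy⟩ := hnc
    exact ⟨x, hx, y, hy, fun h => hxy (h ▸ rfl)⟩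
  have hRH := RH_pos hcpt convex_feasible hpos hnt
  have hR1 := R1_pos hcpt hnt
  have hδpos := delta_pos (c := c) (B := B) hcpt hhull hfin
  have hδtop := delta_ne_top hcpt hhull hfin hne hnc
  refine ⟨⟨hRH, hR1, alpha_pos hcpt hhull hfin hne, gamma_pos hcpt hhull hfin, hδpos, hδtop⟩, ?_⟩
  intro ε hε hα hγ hδε x hx
  have hδ : delta (feasible A b) c B = ((delta (feasible A b) c B).toReal : EReal) :=
    (EReal.coe_toReal hδtop (EReal.bot_lt_zero.trans hδpos).ne').symm
  obtain ⟨v, hv, hu⟩ := hx.exists_optVertex hcpt hhull hfin hε hRH hα hγ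
  have hinf : sInf (quad (B.transpose * B) c '' feasible A b) = quad (B.transpose * B) c v :=
    IsLeast.csInf_eq ⟨⟨v, hv.1.1, rfl⟩, by
      rintro _ ⟨y, hy, rfl⟩
      exact quad_le_of_mem_optVertices hcpt hhull hv hy⟩
  rw [hinf]
  refine ⟨sub_nonneg.2 (quad_le_of_mem_optVertices hcpt hhull hv hx.1), ?_⟩
  rw [EReal.lt_div_iff (EReal.coe_pos.2 (by positivity)) (EReal.coe_ne_top _), ← EReal.coe_mul,
    hδ, EReal.coe_lt_coe_iff] at hδε
  rw [hδ, EReal.coe_pos] at hδpos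
  exact hx.quad_sub_le hcpt hpos hhull hfin hε hRH hR1 hδ hδpos hδε.le hv hu
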